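/- Consider qubits located at the sites of a $D$-dimensional hypercubic lattice of linear size $L$ (with open or periodic boundary conditions), and let $\mathcal S$ be a set of mutually commuting orthogonal projectors on the Hilbert space of these qubits, each acting trivially outside some hypercube of linear size $w$. The code space is the simultaneous eigenspace with eigenvalue one of all the projectors in $\mathcal S$; $\mathcal S$ together with its code space is a local commuting projector code. A set $M$ of qubits is correctable if erasure of the qubits in $M$ can be reversed, for all states on the code space, by a completely positive trace-preserving recovery map. Let $M'$ be the union of the supports of all projectors in $\mathcal S$ that act nontrivially on $M$; put $\partial_+M=M'\cap M^c$, $\partial_-M=(M^c)'\cap M$, and $M^\circ=M\setminus\partial_-M$. A logical operator is a linear operator that maps the code space into itself, and two logical operators are equivalent if they have the same action on the code space. Lemma 9 (Cleaning Lemma for local commuting projector codes). Suppose that $M$ and $\partial_+M$ are both correctable. Then for every logical operator $W$ there exists an equivalent logical operator $V$ supported on the complement of the interior $M^\circ$ of $M$. If $W$ is an isometry on the code space, then $V$ can be chosen to be unitary. -/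

import Mathlib

open scoped ComplexOrder

/-! ### Qubits, operators and supports -/

/-- Computational basis labels for a family of qubits located at the sites `Λ`. -/
abbrev Config (Λ : Type*) : Type _ := Λ → Fin 2

/-- The Hilbert space `(ℂ²)^{⊗ Λ}` of the qubits at the sites `Λ`, in the computational basis. -/
abbrev QubitSpace (Λ : Type*) : Type _ := EuclideanSpace ℂ (Config Λ)

/-- Linear operators on the qubits at `Λ`, as matrices in the computational basis. -/
abbrev QubitOp (Λ : Type*) : Type _ := Matrix (Config Λ) (Config Λ) ℂ

open Classical in
/-- `O` is supported on `M`: it has the form `K ⊗ I`, with `K` an operator on the qubits in `M` and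
`I` the identity on the qubits outside `M`. -/
def SupportedOn {Λ : Type*} (O : QubitOp Λ) (M : Set Λ) : Prop :=
  ∃ K : QubitOp M, ∀ s t : Config Λ,
    O s t = if ∀ q, q ∉ M → s q = t q then K (fun q => s q) (fun q => t q) else 0

/-- `O` acts nontrivially on the set of qubits `M`: it is not of the form `I ⊗ K` with `I` the
identity on the qubits in `M`. -/
def ActsNontriviallyOn {Λ : Type*} (O : QubitOp Λ) (M : Set Λ) : Prop :=
  ¬ SupportedOn O Mᶜ

/-- The support of `O`: the set of qubits on which it acts nontrivially. -/
def opSupport {Λ : Type*} (O : QubitOp Λ) : Set Λ :=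
  {q | ActsNontriviallyOn O {q}}

/-! ### Partial trace and quantum channels -/

open Classical in
/-- The configuration that equals `m` on `M` and `u` outside `M`. -/
noncomputable def glueConfig {Λ : Type*} (M : Set Λ) (m : Config M) (u : Config (Mᶜ : Set Λ)) :
    Config Λ :=
  fun q => if h : q ∈ M then m ⟨q, h⟩ else u ⟨q, h⟩

open Classical in
/-- The partial trace over the qubits in `M`, i.e. the erasure of `M`. -/
noncomputable def partialTrace {Λ : Type*} [Fintype Λ] (M : Set Λ) (X : QubitOp Λ) :
    QubitOp (Mᶜ : Set Λ) :=
  Matrix.of fun u v => ∑ m : Config M, X (glueConfig M m u) (glueConfig M m v)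

/-- A linear map `Φ` between matrix algebras is completely positive: for every `k`, the map
`id_k ⊗ Φ` (apply `Φ` to each block of a `k × k` block matrix) preserves positive
semidefiniteness. -/
def IsCompletelyPositive {m n : Type*} (Φ : Matrix m m ℂ →ₗ[ℂ] Matrix n n ℂ) : Prop :=
  ∀ (k : ℕ) (X : Matrix (Fin k × m) (Fin k × m) ℂ), X.PosSemidef →
    (Matrix.of fun p q : Fin k × n =>
      Φ (Matrix.of fun a b : m => X (p.1, a) (q.1, b)) p.2 q.2).PosSemidef

/-- A quantum channel: a completely positive trace-preserving linear map between matrix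
algebras. -/
structure QuantumChannel (m n : Type*) [Fintype m] [Fintype n] where
  /-- the underlying linear map -/
  toLinearMap : Matrix m m ℂ →ₗ[ℂ] Matrix n n ℂ
  completelyPositive : IsCompletelyPositive toLinearMap
  trace_apply : ∀ X : Matrix m m ℂ, (toLinearMap X).trace = X.trace

/-! ### Commuting projector codes -/

/-- A finite set of mutually commuting orthogonal projections on the qubits at the sites `Λ`. -/
structure CommutingProjectorCode (Λ : Type*) [Fintype Λ] [DecidableEq Λ] where
  /-- the projectors defining the code -/
  projectors : Finset (QubitOp Λ)
  isStarProjection : ∀ P ∈ projectors, IsStarProjection P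
  commute : ∀ P ∈ projectors, ∀ Q ∈ projectors, Commute P Q

namespace CommutingProjectorCode

variable {Λ : Type*} [Fintype Λ] [DecidableEq Λ] (C : CommutingProjectorCode Λ)

/-- The code space: the simultaneous eigenspace with eigenvalue one of all the projectors. -/
noncomputable def codeSpace : Submodule ℂ (QubitSpace Λ) :=
  ⨅ P ∈ C.projectors, Module.End.eigenspace (Matrix.toEuclideanLin P) 1

/-- A density operator supported on the code space. -/
def IsCodeState (ρ : QubitOp Λ) : Prop :=
  ρ.PosSemidef ∧ ρ.trace = 1 ∧ LinearMap.range (Matrix.toEuclideanLin ρ) ≤ C.codeSpace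

open Classical in
/-- `M` is correctable: erasure of the qubits in `M` can be reversed, on the code space, by a
completely positive trace-preserving recovery map. -/
def Correctable (M : Set Λ) : Prop :=
  ∃ R : QuantumChannel (Config (Mᶜ : Set Λ)) (Config Λ),
    ∀ ρ : QubitOp Λ, C.IsCodeState ρ → R.toLinearMap (partialTrace M ρ) = ρ

/-- `M'`: the union of the supports of all the projectors that act nontrivially on `M`. -/
def neighborhood (M : Set Λ) : Set Λ :=
  {q | ∃ P ∈ C.projectors, ActsNontriviallyOn P M ∧ q ∈ opSupport P}

/-- The external boundary `∂₊M = M' ∩ Mᶜ`. -/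
def externalBoundary (M : Set Λ) : Set Λ := C.neighborhood M ∩ Mᶜ

/-- The internal boundary `∂₋M = (Mᶜ)' ∩ M`. -/
def internalBoundary (M : Set Λ) : Set Λ := C.neighborhood Mᶜ ∩ M

/-- The interior `M° = M \ ∂₋M`. -/
def interior (M : Set Λ) : Set Λ := M \ C.internalBoundary M

/-- A logical operator: an operator that preserves the code space. -/
def IsLogical (W : QubitOp Λ) : Prop :=
  ∀ ψ ∈ C.codeSpace, Matrix.toEuclideanLin W ψ ∈ C.codeSpace

/-- Two operators are equivalent if they have the same action on the code space. -/
def Equivalent (W V : QubitOp Λ) : Prop :=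
  ∀ ψ ∈ C.codeSpace, Matrix.toEuclideanLin W ψ = Matrix.toEuclideanLin V ψ

/-- `W` acts isometrically on the code space. -/
def IsIsometric (W : QubitOp Λ) : Prop :=
  ∀ ψ ∈ C.codeSpace, ‖Matrix.toEuclideanLin W ψ‖ = ‖ψ‖

end CommutingProjectorCode

/-! ### Locality on a hypercubic lattice -/

/-- Boundary conditions of a hypercubic lattice. -/
inductive BoundaryCondition where
  | opened
  | periodic

/-- The sites of the `D`-dimensional hypercubic lattice of linear size `L`. -/
abbrev LatticeSite (D L : ℕ) : Type := Fin D → Fin L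

/-- The part of the lattice inside the hypercube of linear size `w` with lowest corner `a`; for
periodic boundary conditions coordinates are taken modulo `L`. -/
def hypercube {D L : ℕ} (w : ℕ) : BoundaryCondition → (Fin D → ℤ) → Set (LatticeSite D L)
  | .opened, a => {x | ∀ i, ∃ k : ℕ, k < w ∧ ((x i : ℕ) : ℤ) = a i + k}
  | .periodic, a => {x | ∀ i, ∃ k : ℕ, k < w ∧ ((x i : ℕ) : ℤ) ≡ a i + k [ZMOD L]}

/-- The code is geometrically local with interaction range `w`: every projector acts trivially
outside some hypercube of linear size `w`. -/
def CommutingProjectorCode.IsLocal {D L : ℕ} (C : CommutingProjectorCode (LatticeSite D L))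
    (bc : BoundaryCondition) (w : ℕ) : Prop :=
  ∀ P ∈ C.projectors, ∃ a : Fin D → ℤ, SupportedOn P (hypercube w bc a)

/-! Write `E m` for the component map of a state along the basis state `m` of `M`, and `K a` for the
Kraus operators of a recovery map. Recovery fixes pure code states, so `∑ |K a E m ψ⟩⟨K a E m ψ| =
|ψ⟩⟨ψ|`; hence `K a E m` is a scalar on the code space (`Correctable.exists_kraus`). Then `V = ∑ (K
a)† W (K a)` acts on `Mᶜ` and, since `∑ (K a)† (K a) = 1`, satisfies `V E m = E m W` on the code
space (`exists_intertwining`). So `I ⊗ V` is equivalent to `W` and supported on `Mᶜ ⊆ (M°)ᶜ`. For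
isometric `W`, this `V` is isometric on the span of the erased code vectors and extends from there
to a unitary on `Mᶜ` (`exists_isometry_intertwining`). -/

open scoped InnerProductSpace Kronecker

/-! ### Kraus decomposition -/

open scoped MatrixOrder in
/-- A completely positive map has Kraus operators, obtained by factoring its Choi matrix. -/
theorem IsCompletelyPositive.exists_kraus {m n : Type*} [Fintype m] [DecidableEq m] [Fintype n]
    {Φ : Matrix m m ℂ →ₗ[ℂ] Matrix n n ℂ} (hΦ : IsCompletelyPositive Φ) :
    ∃ (N : ℕ) (K : Fin N → Matrix n m ℂ), ∀ x y : m → ℂ,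
      Φ (Matrix.vecMulVec x (star y)) =
        ∑ a, Matrix.vecMulVec ((K a).mulVec x) (star ((K a).mulVec y)) := by
  classical
  let e : Fin (Fintype.card m) ≃ m := (Fintype.equivFin m).symm
  -- Unnormalised maximally entangled vector: the blocks of `|v⟩⟨v|` are the matrix units, so
  -- `hchoi` is positivity of the Choi matrix.
  let v : Fin (Fintype.card m) × m → ℂ := fun p => if e p.1 = p.2 then 1 else 0
  have hchoi := hΦ _ _ (Matrix.posSemidef_vecMulVec_self_star v)
  have hsingle : ∀ i j, (Matrix.of fun a b : m => Matrix.vecMulVec v (star v) (i, a) (j, b)) =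
      Matrix.single (e i) (e j) (1 : ℂ) := by
    intro i j
    ext a b
    by_cases h1 : e i = a <;> by_cases h2 : e j = b <;>
      simp [v, Matrix.vecMulVec_apply, h1, h2]
  simp only [hsingle] at hchoi
  obtain ⟨B, hB⟩ := CStarAlgebra.nonneg_iff_eq_star_mul_self.mp hchoi.nonneg
  let r : Fin (Fintype.card (Fin (Fintype.card m) × n)) ≃ Fin (Fintype.card m) × n :=
    (Fintype.equivFin _).symm
  -- Each row of `B`, conjugated and reshaped into a matrix, is one Kraus operator.
  refine ⟨_, fun a => Matrix.of fun p i => star (B (r a) (e.symm i, p)), fun x y => ?_⟩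
  have hentry : ∀ i j p q, Φ (Matrix.single i j 1) p q =
      ∑ a, star (B (r a) (e.symm i, p)) * B (r a) (e.symm j, q) := by
    intro i j p q
    have := congrFun (congrFun hB (e.symm i, p)) (e.symm j, q)
    simp only [Matrix.of_apply, Equiv.apply_symm_apply] at this
    rw [this, Matrix.mul_apply, ← r.sum_comp]
    simp [Matrix.star_apply]
  ext p q
  have hx : Matrix.vecMulVec x (star y) =
      ∑ i, ∑ j, (x i * star (y j)) • Matrix.single i j (1 : ℂ) := by
    rw [Matrix.matrix_eq_sum_single (Matrix.vecMulVec x (star y))]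
    simp [Matrix.vecMulVec_apply, Matrix.smul_single]
  rw [hx]
  simp only [map_sum, map_smul, Matrix.sum_apply, Matrix.smul_apply, hentry, Matrix.vecMulVec_apply,
    Matrix.mulVec, dotProduct, Matrix.of_apply, Pi.star_apply, star_sum, star_mul', star_star,
    smul_eq_mul, Finset.sum_mul_sum]
  simp only [Finset.mul_sum]
  rw [Finset.sum_congr rfl fun i _ => Finset.sum_comm, Finset.sum_comm]
  refine Finset.sum_congr rfl fun a _ => Finset.sum_congr rfl fun i _ =>
    Finset.sum_congr rfl fun j _ => ?_
  ring

/-! ### Operators on the environment side of a correctable erasure -/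

section Abstract

variable {H G : Type*} [NormedAddCommGroup H] [InnerProductSpace ℂ H] [FiniteDimensional ℂ H]
  [NormedAddCommGroup G] [InnerProductSpace ℂ G] [FiniteDimensional ℂ G]

/-- If `A` maps every unit vector of `S` into its own span, it is a scalar on `S`. -/
theorem exists_smul_of_inner_eq_zero {S : Submodule ℂ H} {A : H →ₗ[ℂ] H}
    (h : ∀ ψ ∈ S, ‖ψ‖ = 1 → ∀ χ : H, ⟪χ, ψ⟫_ℂ = 0 → ⟪χ, A ψ⟫_ℂ = 0) :
    ∃ c : ℂ, ∀ ψ ∈ S, A ψ = c • ψ := by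
  have key : ∀ ψ ∈ S, ∃ c : ℂ, c • ψ = A ψ := by
    intro ψ hψ
    by_cases h0 : ψ = 0
    · exact ⟨0, by simp [h0]⟩
    rw [← Submodule.mem_span_singleton, ← Submodule.orthogonal_orthogonal (Submodule.span ℂ {ψ}),
      Submodule.mem_orthogonal]
    intro χ hχ
    have hχψ := Submodule.mem_orthogonal_singleton_iff_inner_left.mp hχ
    have hn : (‖ψ‖ : ℂ) ≠ 0 := by simpa using h0
    have := h ((‖ψ‖ : ℂ)⁻¹ • ψ) (S.smul_mem _ hψ) (by
      rw [norm_smul, norm_inv, Complex.norm_real, norm_norm]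
      exact inv_mul_cancel₀ (by simpa using h0)) χ (by rw [inner_smul_right, hχψ, mul_zero])
    rw [map_smul, inner_smul_right] at this
    exact (mul_eq_zero.mp this).resolve_left (inv_ne_zero hn)
  have hmaps : ∀ ψ ∈ S, A ψ ∈ S := fun ψ hψ => by
    obtain ⟨c, hc⟩ := key ψ hψ
    exact hc ▸ S.smul_mem c hψ
  -- A linear map for which every vector is an eigenvector is a scalar, so `c` no longer depends on
  -- `ψ`.
  obtain ⟨c, hc⟩ := LinearMap.exists_eq_smul_id_of_forall_notLinearIndependent
    (f := A.restrict hmaps) (fun ψ hli => by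
      obtain ⟨c, hc⟩ := key ψ ψ.2
      rw [LinearIndependent.pair_iff] at hli
      have := hli c (-1) (Subtype.ext (by simp [hc]))
      simp at this)
  refine ⟨c, fun ψ hψ => ?_⟩
  simpa using congrArg Subtype.val (LinearMap.congr_fun hc ⟨ψ, hψ⟩)

variable {ι κ : Type*} [Fintype κ] {S : Submodule ℂ H} {E : ι → H →ₗ[ℂ] G}
  {K : κ → G →ₗ[ℂ] H} {W : H →ₗ[ℂ] H}

/-- If the Kraus operators `K` reverse the erasure with components `E` on `S`, every operator
preserving `S` is implemented by an operator on the unerased system. -/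
theorem exists_intertwining
    (hK : ∀ x y : G, ∑ a, ⟪K a x, K a y⟫_ℂ = ⟪x, y⟫_ℂ)
    (hKE : ∀ a i, ∃ c : ℂ, ∀ ψ ∈ S, K a (E i ψ) = c • ψ)
    (hW : ∀ ψ ∈ S, W ψ ∈ S) :
    ∃ V : G →ₗ[ℂ] G, ∀ i, ∀ ψ ∈ S, V (E i ψ) = E i (W ψ) := by
  refine ⟨∑ a, (K a).adjoint ∘ₗ W ∘ₗ K a, fun i ψ hψ => ext_inner_left ℂ fun x => ?_⟩
  rw [← hK x (E i (W ψ))]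
  simp only [LinearMap.sum_apply, LinearMap.comp_apply, inner_sum, LinearMap.adjoint_inner_right]
  refine Finset.sum_congr rfl fun a _ => ?_
  obtain ⟨c, hc⟩ := hKE a i
  rw [hc ψ hψ, hc _ (hW ψ hψ), map_smul]

/-- An operator that is isometric on `S` is implemented by an isometry of the unerased system. -/
theorem exists_isometry_intertwining
    (hK : ∀ x y : G, ∑ a, ⟪K a x, K a y⟫_ℂ = ⟪x, y⟫_ℂ)
    (hKE : ∀ a i, ∃ c : ℂ, ∀ ψ ∈ S, K a (E i ψ) = c • ψ)
    (hW : ∀ ψ ∈ S, W ψ ∈ S) (hiso : ∀ ψ ∈ S, ‖W ψ‖ = ‖ψ‖) :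
    ∃ V : G →ₗᵢ[ℂ] G, ∀ i, ∀ ψ ∈ S, V (E i ψ) = E i (W ψ) := by
  obtain ⟨V, hV⟩ := exists_intertwining hK hKE hW
  let T : Submodule ℂ G := ⨆ i, S.map (E i)
  have hmem : ∀ i, ∀ ψ ∈ S, E i ψ ∈ T := fun i ψ hψ =>
    Submodule.mem_iSup_of_mem i (Submodule.mem_map_of_mem hψ)
  -- Both claims are linear in `x`, so it suffices to check the generators `E i ψ`.
  have hT : ∀ x ∈ T, ∀ a, K a x ∈ S ∧ K a (V x) = W (K a x) := by
    intro x hx a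
    induction hx using Submodule.iSup_induction' with
    | mem i x hx =>
      obtain ⟨ψ, hψ, rfl⟩ := hx
      obtain ⟨c, hc⟩ := hKE a i
      rw [hV i ψ hψ, hc ψ hψ, hc _ (hW ψ hψ), map_smul]
      exact ⟨S.smul_mem c hψ, rfl⟩
    | zero => simp
    | add x y _ _ hx hy =>
      simp only [map_add, hx.2, hy.2, and_true]
      exact S.add_mem hx.1 hy.1
  -- Norms on `G` are read off after applying the `K a`, where `V` turns into `W`, an isometry on
  -- `S`.
  have hnorm : ∀ x : G, ((‖x‖ ^ 2 : ℝ) : ℂ) = ∑ a, ((‖K a x‖ ^ 2 : ℝ) : ℂ) := fun x => by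
    have := hK x x
    simp only [inner_self_eq_norm_sq_to_K] at this
    push_cast
    exact this.symm
  let U : T →ₗᵢ[ℂ] G :=
    { toLinearMap := V ∘ₗ T.subtype
      norm_map' := fun x => by
        have h : ((‖V x‖ ^ 2 : ℝ) : ℂ) = ((‖(x : G)‖ ^ 2 : ℝ) : ℂ) := by
          rw [hnorm, hnorm]
          refine Finset.sum_congr rfl fun a _ => ?_
          rw [(hT x x.2 a).2, hiso _ (hT x x.2 a).1]
        exact (sq_eq_sq₀ (norm_nonneg _) (norm_nonneg _)).mp (Complex.ofReal_injective h) }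
  refine ⟨U.extend, fun i ψ hψ => ?_⟩
  rw [← hV i ψ hψ]
  exact U.extend_apply ⟨E i ψ, hmem i ψ hψ⟩

end Abstract

/-! ### Bipartitions of the qubits -/

open Classical in
/-- A configuration is a configuration on `M` together with one on the complement of `M`. -/
noncomputable def glueEquiv {Λ : Type*} (M : Set Λ) :
    Config M × Config (Mᶜ : Set Λ) ≃ Config Λ where
  toFun p := glueConfig M p.1 p.2
  invFun s := (fun q => s q, fun q => s q)
  left_inv p := by
    ext q
    · simp [glueConfig]
    · simp [glueConfig, show (q : Λ) ∉ M from q.2]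
  right_inv s := by
    funext q
    by_cases h : q ∈ M <;> simp [glueConfig, h]

/-- The components of a state vector along the basis of the qubits in `M`. -/
noncomputable def erasureComponent {Λ : Type*} (M : Set Λ) (m : Config M) :
    QubitSpace Λ →ₗ[ℂ] QubitSpace (Mᶜ : Set Λ) where
  toFun ψ := WithLp.toLp 2 fun u => ψ (glueConfig M m u)
  map_add' _ _ := rfl
  map_smul' _ _ := rfl

open Classical in
/-- The operator `I ⊗ K` for `K` acting on the complement of `M`. -/
noncomputable def liftOp {Λ : Type*} (M : Set Λ) (K : QubitOp (Mᶜ : Set Λ)) : QubitOp Λ :=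
  ((1 : QubitOp M) ⊗ₖ K).submatrix (glueEquiv M).symm (glueEquiv M).symm

theorem liftOp_supportedOn {Λ : Type*} (M : Set Λ) (K : QubitOp (Mᶜ : Set Λ)) :
    SupportedOn (liftOp M K) Mᶜ := by
  classical
  refine ⟨K, fun s t => ?_⟩
  have : (fun q : M => s q) = (fun q : M => t q) ↔ ∀ q, q ∉ Mᶜ → s q = t q := by
    simp [funext_iff]
  simp [liftOp, glueEquiv, Matrix.one_apply, this]

theorem SupportedOn.mono {Λ : Type*} {O : QubitOp Λ} {A B : Set Λ} (h : SupportedOn O A)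
    (hAB : A ⊆ B) : SupportedOn O B := by
  classical
  obtain ⟨K, hK⟩ := h
  -- The enlarged operator is `K` tensored with the identity on `B \ A`.
  refine ⟨Matrix.of fun s t => if ∀ q : B, (q : Λ) ∉ A → s q = t q then
    K (fun q => s ⟨q, hAB q.2⟩) (fun q => t ⟨q, hAB q.2⟩) else 0, fun s t => ?_⟩
  rw [hK]
  simp only [Matrix.of_apply, ← ite_and]
  refine if_congr ?_ rfl rfl
  constructor
  · exact fun h => ⟨fun q hq => h q fun hA => hq (hAB hA), fun q hq => h q hq⟩
  · rintro ⟨h1, h2⟩ q hq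
    by_cases hB : q ∈ B
    · exact h2 ⟨q, hB⟩ hq
    · exact h1 q hB

theorem liftOp_mem_unitaryGroup {Λ : Type*} [Fintype Λ] [DecidableEq Λ] (M : Set Λ)
    [Fintype (Mᶜ : Set Λ)] {K : QubitOp (Mᶜ : Set Λ)}
    (hK : K ∈ Matrix.unitaryGroup (Config (Mᶜ : Set Λ)) ℂ) :
    liftOp M K ∈ Matrix.unitaryGroup (Config Λ) ℂ := by
  classical
  rw [Matrix.mem_unitaryGroup_iff, Matrix.star_eq_conjTranspose] at hK ⊢
  rw [liftOp, Matrix.conjTranspose_submatrix, Matrix.submatrix_mul_equiv,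
    Matrix.conjTranspose_kronecker, ← Matrix.mul_kronecker_mul, hK]
  simp

/-- The identity factor does not mix the components along `M`; this carries the intertwining
relation from `Mᶜ` back to the full space. -/
theorem erasureComponent_liftOp {Λ : Type*} [Fintype Λ] [DecidableEq Λ] (M : Set Λ)
    [Fintype (Mᶜ : Set Λ)] (K : QubitOp (Mᶜ : Set Λ)) (m : Config M)
    (ψ : QubitSpace Λ) :
    erasureComponent M m (Matrix.toEuclideanLin (liftOp M K) ψ) =
      Matrix.toEuclideanLin K (erasureComponent M m ψ) := by
  classical
  ext u
  change ∑ t, liftOp M K (glueEquiv M (m, u)) t * ψ t = ∑ v, K u v * ψ (glueEquiv M (m, v))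
  rw [← (glueEquiv M).sum_comp, Fintype.sum_prod_type]
  rw [Finset.sum_eq_single m]
  · simp [liftOp]
  · intro m' _ hm'
    refine Finset.sum_eq_zero fun v _ => ?_
    simp [liftOp, hm'.symm]
  · simp

theorem ext_erasureComponent {Λ : Type*} (M : Set Λ) {ψ φ : QubitSpace Λ}
    (h : ∀ m, erasureComponent M m ψ = erasureComponent M m φ) : ψ = φ := by
  ext s
  obtain ⟨⟨m, u⟩, rfl⟩ := (glueEquiv M).surjective s
  exact congrArg (fun x : QubitSpace (Mᶜ : Set Λ) => x u) (h m)

/-! ### Correctable sets -/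

namespace CommutingProjectorCode

variable {Λ : Type*} [Fintype Λ] [DecidableEq Λ] {C : CommutingProjectorCode Λ}

theorem isCodeState_vecMulVec {ψ : QubitSpace Λ} (hψ : ψ ∈ C.codeSpace) (h1 : ‖ψ‖ = 1) :
    C.IsCodeState (Matrix.vecMulVec ψ (star ψ.ofLp)) := by
  refine ⟨Matrix.posSemidef_vecMulVec_self_star _, ?_, ?_⟩
  · rw [Matrix.trace_vecMulVec, ← EuclideanSpace.inner_eq_star_dotProduct,
      inner_self_eq_norm_sq_to_K, h1]
    simp
  · rintro _ ⟨φ, rfl⟩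
    convert C.codeSpace.smul_mem (star ψ.ofLp ⬝ᵥ φ.ofLp) hψ
    ext s
    simp [Matrix.vecMulVec_mulVec, mul_comm]

open Classical in
/-- The Kraus operators of a recovery map send every component of a code vector to a fixed multiple
of that vector. -/
theorem Correctable.exists_kraus {M : Set Λ} (hM : C.Correctable M) :
    ∃ (N : ℕ) (K : Fin N → QubitSpace (Mᶜ : Set Λ) →ₗ[ℂ] QubitSpace Λ),
      (∀ x y : QubitSpace (Mᶜ : Set Λ), ∑ a, ⟪K a x, K a y⟫_ℂ = ⟪x, y⟫_ℂ) ∧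
      ∀ a m, ∃ c : ℂ, ∀ ψ ∈ C.codeSpace, K a (erasureComponent M m ψ) = c • ψ := by
  classical
  obtain ⟨R, hR⟩ := hM
  obtain ⟨N, K, hK⟩ := R.completelyPositive.exists_kraus
  refine ⟨N, fun a => Matrix.toEuclideanLin (K a), fun x y => ?_, fun a m => ?_⟩
  -- Trace preservation on `|y⟩⟨x|` is the relation `∑ (K a)† (K a) = 1` in matrix elements.
  · have htr := R.trace_apply (Matrix.vecMulVec y (star x.ofLp))
    rw [hK, Matrix.trace_sum] at htr
    simp only [Matrix.trace_vecMulVec] at htr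
    simp only [EuclideanSpace.inner_eq_star_dotProduct]
    exact htr
  · refine exists_smul_of_inner_eq_zero
      (A := Matrix.toEuclideanLin (K a) ∘ₗ erasureComponent M m) fun ψ hψ h1 χ hχ => ?_
    have hfix := hR _ (isCodeState_vecMulVec hψ h1)
    have hpt : partialTrace M (Matrix.vecMulVec ψ (star ψ.ofLp)) =
        ∑ m, Matrix.vecMulVec (erasureComponent M m ψ)
          (star (erasureComponent M m ψ).ofLp) := by
      ext u v
      simp only [partialTrace, Matrix.of_apply, Matrix.sum_apply, Matrix.vecMulVec_apply]
      exact Finset.sum_congr (by ext; simp) fun _ _ => rfl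
    rw [hpt, map_sum] at hfix
    simp only [hK] at hfix
    -- Taking the expectation in `χ ⊥ ψ` kills `|ψ⟩⟨ψ|` and leaves a vanishing sum of squares `|⟨χ,
    -- K a E m ψ⟩|²`, so each term is zero.
    have hquad := congrArg (fun X : QubitOp Λ => star χ.ofLp ⬝ᵥ X.mulVec χ.ofLp) hfix
    have hterm : ∀ x : Config Λ → ℂ,
        star χ.ofLp ⬝ᵥ (Matrix.vecMulVec x (star x)).mulVec χ.ofLp =
          ((‖⟪χ, WithLp.toLp 2 x⟫_ℂ‖ ^ 2 : ℝ) : ℂ) := by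
      intro x
      rw [Matrix.vecMulVec_mulVec, dotProduct_smul, EuclideanSpace.inner_eq_star_dotProduct]
      push_cast
      rw [← Complex.mul_conj', MulOpposite.smul_eq_mul_unop]
      simp only [MulOpposite.unop_op, starRingEnd_apply]
      rw [Matrix.star_dotProduct x, dotProduct_comm x, mul_comm]
    simp only [Matrix.sum_mulVec, dotProduct_sum, hterm, WithLp.toLp_ofLp, hχ, norm_zero,
      zero_pow two_ne_zero] at hquad
    norm_cast at hquad
    rw [Finset.sum_eq_zero_iff_of_nonneg
      fun _ _ => Finset.sum_nonneg fun _ _ => sq_nonneg _] at hquad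
    have hm := (Finset.sum_eq_zero_iff_of_nonneg fun _ _ => sq_nonneg _).mp
      (hquad m (Finset.mem_univ _)) a (Finset.mem_univ _)
    exact norm_eq_zero.mp ((pow_eq_zero_iff two_ne_zero).mp hm)

/-- Logical operators can be cleaned off a correctable set; no locality is involved. -/
theorem Correctable.exists_equivalent {M : Set Λ} (hM : C.Correctable M) {W : QubitOp Λ}
    (hW : C.IsLogical W) :
    ∃ V : QubitOp Λ, C.Equivalent W V ∧ SupportedOn V Mᶜ := by
  classical
  obtain ⟨N, K, hK, hKE⟩ := hM.exists_kraus
  obtain ⟨V, hV⟩ := exists_intertwining hK hKE hW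
  refine ⟨liftOp M (Matrix.toEuclideanLin.symm V), fun ψ hψ => ext_erasureComponent M fun m => ?_,
    liftOp_supportedOn M _⟩
  rw [erasureComponent_liftOp, LinearEquiv.apply_symm_apply, hV m ψ hψ]

theorem Correctable.exists_unitary_equivalent {M : Set Λ} (hM : C.Correctable M) {W : QubitOp Λ}
    (hW : C.IsLogical W) (hiso : C.IsIsometric W) :
    ∃ V : QubitOp Λ, C.Equivalent W V ∧ SupportedOn V Mᶜ ∧
      V ∈ Matrix.unitaryGroup (Config Λ) ℂ := by
  classical
  obtain ⟨N, K, hK, hKE⟩ := hM.exists_kraus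
  obtain ⟨V, hV⟩ := exists_isometry_intertwining hK hKE hW hiso
  refine ⟨liftOp M (Matrix.toEuclideanLin.symm V.toLinearMap),
    fun ψ hψ => ext_erasureComponent M fun m => ?_, liftOp_supportedOn M _,
    liftOp_mem_unitaryGroup M ?_⟩
  · rw [erasureComponent_liftOp, LinearEquiv.apply_symm_apply]
    exact (hV m ψ hψ).symm
  -- For a square matrix `A† A = 1` suffices, and this says that `V` preserves inner products.
  · rw [Matrix.mem_unitaryGroup_iff', Matrix.star_eq_conjTranspose]
    apply Matrix.toEuclideanLin.injective
    refine LinearMap.ext fun x => ext_inner_left ℂ fun y => ?_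
    have hmul : ∀ A : QubitOp (Mᶜ : Set Λ), Matrix.toEuclideanLin (A.conjTranspose * A) x =
        (Matrix.toEuclideanLin A).adjoint (Matrix.toEuclideanLin A x) := by
      intro A
      rw [← Matrix.toEuclideanLin_conjTranspose_eq_adjoint]
      simp [Matrix.toLpLin_apply]
    rw [hmul, LinearEquiv.apply_symm_apply, LinearMap.adjoint_inner_right]
    simp

theorem Equivalent.isLogical {W V : QubitOp Λ} (h : C.Equivalent W V) (hW : C.IsLogical W) :
    C.IsLogical V := fun ψ hψ => h ψ hψ ▸ hW ψ hψ

end CommutingProjectorCode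

theorem lemma9 {D L w : ℕ} {bc : BoundaryCondition}
    (C : CommutingProjectorCode (LatticeSite D L)) (hC : C.IsLocal bc w)
    (M : Set (LatticeSite D L))
    (hM : C.Correctable M) (hM' : C.Correctable (C.externalBoundary M))
    (W : QubitOp (LatticeSite D L)) (hW : C.IsLogical W) :
    (∃ V : QubitOp (LatticeSite D L),
      C.IsLogical V ∧ C.Equivalent W V ∧ SupportedOn V (C.interior M)ᶜ) ∧
    (C.IsIsometric W →
      ∃ V : QubitOp (LatticeSite D L),
        C.IsLogical V ∧ C.Equivalent W V ∧ SupportedOn V (C.interior M)ᶜ ∧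
        V ∈ Matrix.unitaryGroup (Config (LatticeSite D L)) ℂ) := by
  have hsub : Mᶜ ⊆ (C.interior M)ᶜ := Set.compl_subset_compl.mpr Set.sdiff_subset
  refine ⟨?_, fun hiso => ?_⟩
  · obtain ⟨V, hWV, hV⟩ := hM.exists_equivalent hW
    exact ⟨V, hWV.isLogical hW, hWV, hV.mono hsub⟩
  · obtain ⟨V, hWV, hV, hU⟩ := hM.exists_unitary_equivalent hW hiso
    exact ⟨V, hWV.isLogical hW, hWV, hV.mono hsub, hU⟩
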